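/- Let $G$ be a finite graph in which loops and multiple edges are allowed, and let $d_G(v)$ denote the degree of a vertex $v$, i.e. the number of half-edges at $v$ (each loop at $v$ counts twice). The odd-edge-connectivity of $G$ is the smallest size of an edge cut $\{e \in E(G) : e \text{ has one end in } X \text{ and the other in } V(G)\setminus X\}$, $X\subseteq V(G)$, having an odd number of edges (and $\infty$ if there is no such cut). Let $p\ge 0$ be an integer. Suppose that $G$ has odd-edge-connectivity at least $2p+1$, and that there is a mapping $\mu : V(G)\to\mathbb Z^{+}$ into the positive integers such that $d_G(v) = (2p+1)\mu(v)$ for every $v\in V(G)$. Then $G$ has a spanning subgraph $F$ (a subgraph with $V(F)=V(G)$) such that $d_F(v) = p\,\mu(v)$ for every $v\in V(G)$. -/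

import Mathlib

namespace Graph

/-- The degree of a vertex of a multigraph: the number of half-edges at `v`,
so that a loop at `v` counts twice. -/
noncomputable def vertexDegree {α β : Type*} (G : Graph α β) (v : α) : ℕ :=
  {e | G.IsNonloopAt e v}.ncard + 2 * {e | G.IsLoopAt e v}.ncard

/-- The edge cut determined by a set `X` of vertices: all edges with one end in `X` and
the other end outside `X`. -/
def edgeCut {α β : Type*} (G : Graph α β) (X : Set α) : Set β :=
  {e | ∃ x ∈ X, ∃ y ∉ X, G.IsLink e x y}

/-- The odd-edge-connectivity: the smallest size of an edge cut with an odd number of edges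
(`⊤` if there is no such edge cut). -/
noncomputable def oddEdgeConnectivity {α β : Type*} (G : Graph α β) : ℕ∞ :=
  ⨅ (X : Set α) (_ : (G.edgeCut X).Finite ∧ Odd (G.edgeCut X).ncard), (G.edgeCut X).encard

end Graph

/-! The problem is reduced to a perfect matching in a gadget: one vertex per half-edge, the two
halves of an edge being adjacent, and `(p + 1) * μ v` core vertices at `v`, each adjacent to all
half-edges at `v`. A perfect matching spends `(p + 1) * μ v` half-edges at `v` on the core; the
other `p * μ v` are paired with their opposite halves, and those edges form `F`.

The matching comes from Tutte's theorem, whose condition follows from a fractional perfect matching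
with weight at least 1 across every odd set. Odd-edge-connectivity enters only in this cut bound
(`one_le_sum_gadgetWeight`), through the edgewise estimate `le_sum_cost_or`. -/

/-! ### Fractional matchings and Tutte's condition -/

/-- A graph with edge weights `w` such that the weight at every vertex is at most one and every
odd vertex set has boundary of weight at least one has a perfect matching. -/
theorem SimpleGraph.exists_isPerfectMatching_of_weights {W : Type*} [Fintype W] [DecidableEq W]
    (H : SimpleGraph W) (w : W → W → ℚ) (hw : ∀ a b, 0 ≤ w a b)
    (hadj : ∀ a b, w a b ≠ 0 → H.Adj a b) (hsum : ∀ b, ∑ a, w a b ≤ 1)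
    (hodd : ∀ U : Finset W, Odd U.card → 1 ≤ ∑ a ∈ U, ∑ b ∈ Uᶜ, w a b) :
    ∃ M : H.Subgraph, M.IsPerfectMatching := by
  classical
  rw [SimpleGraph.tutte]
  intro u hu
  unfold SimpleGraph.IsTutteViolator at hu
  set D := (⊤ : H.Subgraph).deleteVerts u with hD
  let U : D.coe.ConnectedComponent → Finset W := fun c =>
    {a | ∃ h : a ∈ D.verts, D.coe.connectedComponentMk ⟨a, h⟩ = c}
  have hmem (c a) : a ∈ U c ↔ ∃ h : a ∈ D.verts, D.coe.connectedComponentMk ⟨a, h⟩ = c := by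
    simp [U]
  have hcard (c : D.coe.ConnectedComponent) : (U c).card = c.supp.ncard := by
    rw [← Set.ncard_image_of_injective c.supp Subtype.val_injective, ← Set.ncard_coe_finset]
    congr 1
    ext a
    simp [hmem, SimpleGraph.ConnectedComponent.mem_supp_iff]
  -- An edge leaving a component of the graph without `u` must end in `u`.
  have hcut (c) (hc : c ∈ D.coe.oddComponents) : 1 ≤ ∑ a ∈ U c, ∑ b ∈ u.toFinset, w a b := by
    refine (hodd (U c) (by rw [hcard]; exact hc)).trans (Finset.sum_le_sum fun a ha => ?_)
    rw [← Finset.sum_filter_ne_zero]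
    refine Finset.sum_le_sum_of_subset_of_nonneg ?_ fun _ _ _ => hw _ _
    intro b hb
    rw [Finset.mem_filter, Finset.mem_compl] at hb
    rw [Set.mem_toFinset]
    by_contra hbu
    apply hb.1
    obtain ⟨haD, hac⟩ := (hmem c a).1 ha
    have hbD : b ∈ D.verts := by simp [hD, hbu]
    refine (hmem c b).2 ⟨hbD, ?_⟩
    rw [← hac, SimpleGraph.ConnectedComponent.eq]
    refine SimpleGraph.Adj.reachable ?_
    have hau : a ∉ u := by simpa [hD] using haD
    exact SimpleGraph.Subgraph.deleteVerts_adj.2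
      ⟨trivial, hbu, trivial, hau, (hadj _ _ hb.2).symm⟩
  have hle : ((D.coe.oddComponents.ncard : ℕ) : ℚ) ≤ u.ncard := by
    -- Each odd component sends weight at least 1 into `u`, and each vertex of `u` receives at most
    -- 1.
    calc ((D.coe.oddComponents.ncard : ℕ) : ℚ)
        = ∑ c ∈ D.coe.oddComponents.toFinset, 1 := by
          rw [Set.ncard_eq_toFinset_card']; simp
      _ ≤ ∑ c ∈ D.coe.oddComponents.toFinset, ∑ a ∈ U c, ∑ b ∈ u.toFinset, w a b :=
          Finset.sum_le_sum fun c hc => hcut c (Set.mem_toFinset.1 hc)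
      _ = ∑ a ∈ D.coe.oddComponents.toFinset.biUnion U, ∑ b ∈ u.toFinset, w a b := by
          refine (Finset.sum_biUnion ?_).symm
          intro c _ d _ hcd
          refine Finset.disjoint_left.2 fun a ha hb => hcd ?_
          obtain ⟨h, rfl⟩ := (hmem c a).1 ha
          obtain ⟨_, rfl⟩ := (hmem d a).1 hb
          rfl
      _ ≤ ∑ a, ∑ b ∈ u.toFinset, w a b :=
          Finset.sum_le_sum_of_subset_of_nonneg (Finset.subset_univ _)
            fun _ _ _ => Finset.sum_nonneg fun _ _ => hw _ _
      _ = ∑ b ∈ u.toFinset, ∑ a, w a b := Finset.sum_comm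
      _ ≤ ∑ b ∈ u.toFinset, 1 := Finset.sum_le_sum fun b _ => hsum b
      _ = u.ncard := by rw [Set.ncard_eq_toFinset_card']; simp
  exact absurd (by exact_mod_cast hle) (not_le.2 hu)

/-! ### The factor gadget and its odd cuts -/

section Gadget

variable {V E : Type*} [DecidableEq V]

/-- An edge crosses exactly when an odd number of its two half-edges is attached inside `X`. -/
lemma even_card_crossing_iff [Fintype E] (φ : E × Bool → V) (X : Finset V) :
    Even (Finset.card {e | ¬(φ (e, false) ∈ X ↔ φ (e, true) ∈ X)}) ↔
      Even (Finset.card {h | φ h ∈ X}) := by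
  rw [Finset.card_filter, Finset.card_filter, Fintype.sum_prod_type]
  simp only [Fintype.sum_bool]
  rw [← Nat.even_add, ← Finset.sum_add_distrib]
  refine Finset.even_sum _ fun e _ => ?_
  by_cases hx : φ (e, false) ∈ X <;> by_cases hy : φ (e, true) ∈ X <;> simp [hx, hy]

variable [DecidableEq E]

/-- The vertices of the factor gadget: half-edges, and `(p + 1) * μ v` core vertices for
each vertex `v`. -/
abbrev GadgetVertex (E : Type*) {V : Type*} (p : ℕ) (μ : V → ℕ) : Type _ :=
  (E × Bool) ⊕ (Σ v, Fin ((p + 1) * μ v))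

/-- A fractional perfect matching of the factor gadget of a multigraph whose half-edge `h` is
attached to the vertex `φ h`. -/
def gadgetWeight (φ : E × Bool → V) (p : ℕ) (μ : V → ℕ) :
    GadgetVertex E p μ → GadgetVertex E p μ → ℚ
  | .inl h, .inl h' => if h' = (h.1, !h.2) then p / (2 * p + 1) else 0
  | .inl h, .inr c => if φ h = c.1 then 1 / ((2 * p + 1) * μ c.1) else 0
  | .inr c, .inl h => if φ h = c.1 then 1 / ((2 * p + 1) * μ c.1) else 0
  | .inr _, .inr _ => 0

lemma gadgetWeight_comm (φ : E × Bool → V) (p : ℕ) (μ : V → ℕ) (a b : GadgetVertex E p μ) :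
    gadgetWeight φ p μ a b = gadgetWeight φ p μ b a := by
  rcases a with ⟨e, s⟩ | c <;> rcases b with ⟨e', s'⟩ | c' <;> simp only [gadgetWeight]
  refine if_congr ?_ rfl rfl
  cases s <;> cases s' <;> simp [eq_comm]

lemma gadgetWeight_nonneg (φ : E × Bool → V) (p : ℕ) (μ : V → ℕ) (a b : GadgetVertex E p μ) :
    0 ≤ gadgetWeight φ p μ a b := by
  rcases a with h | c <;> rcases b with h' | c' <;> simp only [gadgetWeight] <;>
    positivity

/-- The factor gadget. Its perfect matchings correspond to the subgraphs with degree `p * μ v`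
at each vertex `v`, if the degrees are `(2 * p + 1) * μ v`. -/
def gadget (φ : E × Bool → V) (p : ℕ) (μ : V → ℕ) : SimpleGraph (GadgetVertex E p μ) where
  Adj a b := gadgetWeight φ p μ a b ≠ 0
  symm := ⟨fun a b h => by rwa [gadgetWeight_comm]⟩
  loopless := ⟨fun a h => h (by rcases a with ⟨e, s⟩ | c <;> simp [gadgetWeight])⟩

variable [Fintype V] [Fintype E]

lemma sum_gadgetWeight (φ : E × Bool → V) (p : ℕ) (μ : V → ℕ) (hμ : ∀ v, 0 < μ v)
    (hdeg : ∀ v, Finset.card {h | φ h = v} = (2 * p + 1) * μ v) (b : GadgetVertex E p μ) :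
    ∑ a, gadgetWeight φ p μ a b = 1 := by
  simp_rw [fun a => gadgetWeight_comm φ p μ a b]
  rw [Fintype.sum_sum_type]
  rcases b with h | c
  · have := hμ (φ h)
    simp only [gadgetWeight, Finset.sum_ite_eq', Finset.sum_ite_eq, Finset.mem_univ, if_true,
      Fintype.sum_sigma, Finset.sum_const, Finset.card_univ, Fintype.card_fin, smul_ite, smul_zero,
      nsmul_eq_mul]
    push_cast
    field_simp
    ring
  · have := hμ c.1
    simp only [gadgetWeight, Finset.sum_const_zero, add_zero, ← Finset.sum_filter,
      Finset.sum_const, hdeg, nsmul_eq_mul]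
    push_cast
    field_simp

/-- When `U` splits the core at `v`, each of the `(2 * p + 1) * μ v` half-edges at `v` is separated
from one of the core vertices `i`, `j`; `g` records that pair. -/
lemma one_le_sum_gadgetWeight_of_mixed (φ : E × Bool → V) (p : ℕ) (μ : V → ℕ) (hμ : ∀ v, 0 < μ v)
    (hdeg : ∀ v, Finset.card {h | φ h = v} = (2 * p + 1) * μ v)
    (U : Finset (GadgetVertex E p μ)) (v : V) (i j : Fin ((p + 1) * μ v))
    (hi : Sum.inr ⟨v, i⟩ ∈ U) (hj : Sum.inr ⟨v, j⟩ ∉ U) :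
    1 ≤ ∑ a ∈ U, ∑ b ∈ Uᶜ, gadgetWeight φ p μ a b := by
  let g : E × Bool → GadgetVertex E p μ × GadgetVertex E p μ := fun h =>
    if Sum.inl h ∈ U then (.inl h, .inr ⟨v, j⟩) else (.inr ⟨v, i⟩, .inl h)
  have hg : Function.Injective g := by
    intro h h' hh
    simp only [g] at hh
    split_ifs at hh <;> simp_all
  have := hμ v
  calc (1 : ℚ) = ∑ h with φ h = v, (1 : ℚ) / ((2 * p + 1) * μ v) := by
        rw [Finset.sum_const, hdeg, nsmul_eq_mul]
        push_cast
        field_simp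
    _ = ∑ h with φ h = v, gadgetWeight φ p μ (g h).1 (g h).2 := by
        refine Finset.sum_congr rfl fun h hh => ?_
        have hh := (Finset.mem_filter.1 hh).2
        simp only [g]
        split_ifs <;> simp [gadgetWeight, hh]
    _ = ∑ x ∈ ({h | φ h = v} : Finset (E × Bool)).image g, gadgetWeight φ p μ x.1 x.2 :=
        (Finset.sum_image (f := fun x => gadgetWeight φ p μ x.1 x.2) hg.injOn).symm
    _ ≤ ∑ x ∈ U ×ˢ Uᶜ, gadgetWeight φ p μ x.1 x.2 := by
        refine Finset.sum_le_sum_of_subset_of_nonneg ?_ fun _ _ _ => gadgetWeight_nonneg _ _ _ _ _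
        intro x hx
        obtain ⟨h, -, rfl⟩ := Finset.mem_image.1 hx
        simp only [g]
        split_ifs with hU <;> simp [hU, hi, hj]
    _ = _ := Finset.sum_product _ _ _

/-- With no core split, each edge acts as a path core, half, half, core whose links cost `p + 1`,
`p`, `p + 1` in units of `1 / (2 * p + 1)`. -/
lemma sum_gadgetWeight_of_unmixed (φ : E × Bool → V) (p : ℕ) (μ : V → ℕ) (hμ : ∀ v, 0 < μ v)
    (U : Finset (GadgetVertex E p μ)) (X : Finset V) (hX : ∀ c, Sum.inr c ∈ U ↔ c.1 ∈ X) :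
    (2 * p + 1) * ∑ a ∈ U, ∑ b ∈ Uᶜ, gadgetWeight φ p μ a b =
      ((∑ e, ((if (Sum.inl (e, false) ∈ U ↔ Sum.inl (e, true) ∈ U) then 0 else p) +
        (if (Sum.inl (e, false) ∈ U ↔ φ (e, false) ∈ X) then 0 else p + 1) +
        (if (Sum.inl (e, true) ∈ U ↔ φ (e, true) ∈ X) then 0 else p + 1)) : ℕ) : ℚ) := by
  have h1 : ∑ a ∈ U, ∑ b ∈ Uᶜ, gadgetWeight φ p μ a b =
      ∑ a, ∑ b, if a ∈ U ∧ b ∉ U then gadgetWeight φ p μ a b else 0 := by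
    rw [← Finset.sum_product', ← Finset.sum_product', ← Finset.sum_filter]
    refine Finset.sum_congr ?_ fun _ _ => rfl
    ext x
    simp
  have h2 (h : E × Bool) : ∑ h', (if Sum.inl h ∈ U ∧ Sum.inl h' ∉ U then
      gadgetWeight φ p μ (.inl h) (.inl h') else 0) =
      if Sum.inl h ∈ U ∧ Sum.inl (h.1, !h.2) ∉ U then (p / (2 * p + 1) : ℚ) else 0 := by
    rw [Finset.sum_eq_single (h.1, !h.2)]
    · simp [gadgetWeight]
    · intro h' _ hne
      simp [gadgetWeight, hne]
    · simp
  have hval (v : V) : (((p + 1) * μ v : ℕ) : ℚ) * (1 / ((2 * p + 1) * μ v)) =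
      (p + 1) / (2 * p + 1) := by
    have := hμ v
    push_cast
    field_simp
  have h3 (h : E × Bool) : ∑ c, (if Sum.inl h ∈ U ∧ Sum.inr c ∉ U then
      gadgetWeight φ p μ (.inl h) (.inr c) else 0) =
      if Sum.inl h ∈ U ∧ φ h ∉ X then ((p + 1) / (2 * p + 1) : ℚ) else 0 := by
    rw [Fintype.sum_sigma, Finset.sum_eq_single (φ h)]
    · simp only [hX, gadgetWeight, if_true, Finset.sum_const, Finset.card_univ, Fintype.card_fin]
      split_ifs
      · rw [nsmul_eq_mul, hval]
      · simp
    · intro v _ hne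
      simp [gadgetWeight, hne.symm]
    · simp
  have h4 (h : E × Bool) : ∑ c, (if Sum.inr c ∈ U ∧ Sum.inl h ∉ U then
      gadgetWeight φ p μ (.inr c) (.inl h) else 0) =
      if φ h ∈ X ∧ Sum.inl h ∉ U then ((p + 1) / (2 * p + 1) : ℚ) else 0 := by
    rw [Fintype.sum_sigma, Finset.sum_eq_single (φ h)]
    · simp only [hX, gadgetWeight, if_true, Finset.sum_const, Finset.card_univ, Fintype.card_fin]
      split_ifs
      · rw [nsmul_eq_mul, hval]
      · simp
    · intro v _ hne
      simp [gadgetWeight, hne.symm]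
    · simp
  rw [h1]
  simp only [Fintype.sum_sum_type, Finset.sum_add_distrib, h2, h3]
  rw [Finset.sum_comm (s := Finset.univ (α := Σ v, Fin ((p + 1) * μ v)))
    (t := Finset.univ (α := E × Bool))]
  simp only [h4]
  simp only [Fintype.sum_prod_type, Fintype.sum_bool, gadgetWeight, ite_self,
    Finset.sum_const_zero, add_zero, ← Finset.sum_add_distrib]
  rw [Finset.mul_sum, Nat.cast_sum]
  refine Finset.sum_congr rfl fun e _ => ?_
  simp only [Bool.not_true, Bool.not_false]
  by_cases ha : Sum.inl (e, false) ∈ U <;> by_cases hb : Sum.inl (e, true) ∈ U <;>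
    by_cases hx : φ (e, false) ∈ X <;> by_cases hy : φ (e, true) ∈ X <;>
    simp [ha, hb, hx, hy] <;> field_simp

/-- A crossing edge costs at least `p`, so an odd crossing set costs at least `(2 * p + 1) * p`. If
the crossing set is even and some half disagrees with its core, a noncrossing edge there already
costs `2 * p + 1`; a crossing one costs `p + 1`, and parity supplies a second crossing edge of cost
at least `p`. -/
lemma le_sum_cost_or (p : ℕ) (hp : 0 < p) (a b x y : E → Prop) [DecidablePred a]
    [DecidablePred b] [DecidablePred x] [DecidablePred y]
    (hcut : Odd (Finset.card {e | ¬(x e ↔ y e)}) → 2 * p + 1 ≤ Finset.card {e | ¬(x e ↔ y e)}) :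
    2 * p + 1 ≤ ∑ e, ((if (a e ↔ b e) then 0 else p) + (if (a e ↔ x e) then 0 else p + 1) +
        (if (b e ↔ y e) then 0 else p + 1)) ∨
      Even (Finset.card {e | ¬(x e ↔ y e)}) ∧ ∀ e, (a e ↔ x e) ∧ (b e ↔ y e) := by
  set f : E → ℕ := fun e => (if (a e ↔ b e) then 0 else p) + (if (a e ↔ x e) then 0 else p + 1) +
        (if (b e ↔ y e) then 0 else p + 1) with hf
  have hpf (e) (he : ¬(x e ↔ y e)) : p ≤ f e := by
    simp only [hf]
    split_ifs <;> first | omega | tauto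
  by_cases hodd : Odd (Finset.card {e | ¬(x e ↔ y e)})
  · left
    calc 2 * p + 1 ≤ Finset.card {e | ¬(x e ↔ y e)} * p :=
          (hcut hodd).trans (Nat.le_mul_of_pos_right _ hp)
      _ ≤ ∑ e with ¬(x e ↔ y e), f e := by
          rw [← smul_eq_mul]
          exact Finset.card_nsmul_le_sum _ _ _ fun e he => hpf e (Finset.mem_filter.1 he).2
      _ ≤ ∑ e, f e := Finset.sum_le_sum_of_subset (Finset.filter_subset _ _)
  rw [Nat.not_odd_iff_even] at hodd
  by_cases hall : ∀ e, (a e ↔ x e) ∧ (b e ↔ y e)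
  · exact .inr ⟨hodd, hall⟩
  left
  push Not at hall
  obtain ⟨e, he⟩ := hall
  by_cases hxy : x e ↔ y e
  · refine le_trans ?_ (Finset.single_le_sum (f := f) (fun _ _ => Nat.zero_le _)
      (Finset.mem_univ e))
    simp only [hf]
    split_ifs <;> first | omega | tauto
  · have hmem : e ∈ ({e | ¬(x e ↔ y e)} : Finset E) := by simpa using hxy
    have h2 : 1 < Finset.card {e | ¬(x e ↔ y e)} := by
      have := Finset.card_pos.2 ⟨e, hmem⟩
      rcases hodd with ⟨k, hk⟩
      omega
    obtain ⟨e', he', hne⟩ := Finset.exists_mem_ne h2 e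
    have hfe : p + 1 ≤ f e := by
      simp only [hf]
      split_ifs <;> first | omega | tauto
    have hfe' := hpf e' (Finset.mem_filter.1 he').2
    calc 2 * p + 1 ≤ f e + f e' := by omega
      _ = ∑ e ∈ {e, e'}, f e := (Finset.sum_pair hne.symm).symm
      _ ≤ ∑ e, f e := Finset.sum_le_sum_of_subset (Finset.subset_univ _)

lemma one_le_sum_gadgetWeight (φ : E × Bool → V) (p : ℕ) (hp : 0 < p) (μ : V → ℕ)
    (hμ : ∀ v, 0 < μ v) (hdeg : ∀ v, Finset.card {h | φ h = v} = (2 * p + 1) * μ v)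
    (hcut : ∀ X : Finset V, Odd (Finset.card {e | ¬(φ (e, false) ∈ X ↔ φ (e, true) ∈ X)}) →
      2 * p + 1 ≤ Finset.card {e | ¬(φ (e, false) ∈ X ↔ φ (e, true) ∈ X)})
    (U : Finset (GadgetVertex E p μ)) (hU : Odd U.card) :
    1 ≤ ∑ a ∈ U, ∑ b ∈ Uᶜ, gadgetWeight φ p μ a b := by
  by_cases hmix : ∃ v, ∃ i j : Fin ((p + 1) * μ v), Sum.inr ⟨v, i⟩ ∈ U ∧ Sum.inr ⟨v, j⟩ ∉ U
  · obtain ⟨v, i, j, hi, hj⟩ := hmix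
    exact one_le_sum_gadgetWeight_of_mixed φ p μ hμ hdeg U v i j hi hj
  push Not at hmix
  let X : Finset V := {v | ∃ i : Fin ((p + 1) * μ v), Sum.inr ⟨v, i⟩ ∈ U}
  have hX (c : Σ v, Fin ((p + 1) * μ v)) : Sum.inr c ∈ U ↔ c.1 ∈ X := by
    simp only [X, Finset.mem_filter, Finset.mem_univ, true_and]
    exact ⟨fun h => ⟨c.2, h⟩, fun ⟨i, hi⟩ => hmix _ _ _ hi⟩
  have hsum := sum_gadgetWeight_of_unmixed φ p μ hμ U X hX
  rcases le_sum_cost_or p hp (fun e => Sum.inl (e, false) ∈ U) (fun e => Sum.inl (e, true) ∈ U)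
    (fun e => φ (e, false) ∈ X) (fun e => φ (e, true) ∈ X) (hcut X) with hle | ⟨heven, hall⟩
  · have hpos : (0 : ℚ) < 2 * p + 1 := by positivity
    refine le_of_mul_le_mul_left ?_ hpos
    rw [hsum, mul_one]
    exact_mod_cast hle
  · exfalso
    -- Here `U` is exactly the half-edges and cores over `X`. Evenness of `(2 * p + 1) * ∑ v ∈ X, μ
    -- v` makes the sum of `μ` even, hence `U.card` too.
    rw [even_card_crossing_iff] at heven
    have hh (h : E × Bool) : Sum.inl h ∈ U ↔ φ h ∈ X := by
      obtain ⟨e, _ | _⟩ := h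
      exacts [(hall e).1, (hall e).2]
    have hhalf : Finset.card {h | φ h ∈ X} = (2 * p + 1) * ∑ v ∈ X, μ v := by
      rw [Finset.card_eq_sum_card_fiberwise (f := φ) (t := X) (by intro h; simp), Finset.mul_sum]
      refine Finset.sum_congr rfl fun v hv => ?_
      rw [← hdeg, Finset.filter_filter]
      congr 1
      ext h
      simp only [Finset.mem_filter, Finset.mem_univ, true_and]
      exact ⟨fun h => h.2, fun h => ⟨h ▸ hv, h⟩⟩
    have hcard : U.card = (2 * p + 1) * ∑ v ∈ X, μ v + (p + 1) * ∑ v ∈ X, μ v := by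
      rw [← Finset.card_toLeft_add_card_toRight, ← hhalf]
      congr 1
      · congr 1
        ext h
        simp [hh]
      · have : U.toRight = X.sigma fun v => (Finset.univ : Finset (Fin ((p + 1) * μ v))) := by
          ext c
          simp [hX]
        rw [this, Finset.card_sigma, Finset.mul_sum]
        simp
    rw [hhalf] at heven
    rw [hcard] at hU
    have hS : Even (∑ v ∈ X, μ v) := by
      rcases Nat.even_mul.1 heven with h | h
      · exact absurd h (by simp)
      · exact h
    exact (Nat.not_odd_iff_even.2 ((hS.mul_left _).add (hS.mul_left _))) hU

theorem exists_factor_of_halfEdges (φ : E × Bool → V) (p : ℕ) (hp : 0 < p) (μ : V → ℕ)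
    (hμ : ∀ v, 0 < μ v) (hdeg : ∀ v, Finset.card {h | φ h = v} = (2 * p + 1) * μ v)
    (hcut : ∀ X : Finset V, Odd (Finset.card {e | ¬(φ (e, false) ∈ X ↔ φ (e, true) ∈ X)}) →
      2 * p + 1 ≤ Finset.card {e | ¬(φ (e, false) ∈ X ↔ φ (e, true) ∈ X)}) :
    ∃ F : Finset E, ∀ v, Finset.card {h | φ h = v ∧ h.1 ∈ F} = p * μ v := by
  classical
  obtain ⟨M, hM⟩ := (gadget φ p μ).exists_isPerfectMatching_of_weights (gadgetWeight φ p μ)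
    (gadgetWeight_nonneg φ p μ) (fun _ _ h => h)
    (fun b => (sum_gadgetWeight φ p μ hμ hdeg b).le) (one_le_sum_gadgetWeight φ p hp μ hμ hdeg hcut)
  rw [SimpleGraph.Subgraph.isPerfectMatching_iff] at hM
  let F : Finset E := {e | M.Adj (.inl (e, false)) (.inl (e, true))}
  have hF (h : E × Bool) : h.1 ∈ F ↔ M.Adj (.inl h) (.inl (h.1, !h.2)) := by
    obtain ⟨e, _ | _⟩ := h
    · simp [F]
    · simp [F, M.adj_comm]
  have hcore (v : V) (i : Fin ((p + 1) * μ v)) : ∃ h, M.Adj (.inr ⟨v, i⟩) (.inl h) ∧ φ h = v := by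
    obtain ⟨h | c, hb, -⟩ := hM (.inr ⟨v, i⟩)
    · refine ⟨h, hb, ?_⟩
      have := M.adj_sub hb
      simp only [gadget, gadgetWeight] at this
      by_contra hne
      simp [hne] at this
    · exact absurd rfl (M.adj_sub hb)
  choose g hg hφ using hcore
  refine ⟨F, fun v => ?_⟩
  -- Half-edges outside `F` are matched into the core, bijectively with the core vertices at `v`.
  have hout : Finset.card {h | φ h = v ∧ h.1 ∉ F} = (p + 1) * μ v := by
    rw [← Fintype.card_fin ((p + 1) * μ v), ← Finset.card_univ]
    refine (Finset.card_bij (fun i _ => g v i) ?_ ?_ ?_).symm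
    · intro i _
      simp only [Finset.mem_filter, Finset.mem_univ, true_and]
      refine ⟨hφ v i, fun hgF => ?_⟩
      have := (hM _).unique ((hF _).1 hgF) (hg v i).symm
      simp at this
    · intro i _ j _ hij
      have hj := hg v j
      rw [← hij] at hj
      have := (hM _).unique (hg v i).symm hj.symm
      simpa using this
    · intro h hh
      obtain ⟨rfl, hhF⟩ := (Finset.mem_filter.1 hh).2
      obtain ⟨h' | ⟨v, i⟩, hb, -⟩ := hM (.inl h)
      · refine absurd ((hF h).2 ?_) hhF
        have := M.adj_sub hb
        simp only [gadget, gadgetWeight] at this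
        by_cases hne : h' = (h.1, !h.2)
        · rwa [← hne]
        · simp [hne] at this
      · have := M.adj_sub hb
        simp only [gadget, gadgetWeight] at this
        obtain rfl : φ h = v := by
          by_contra hne
          simp [hne] at this
        refine ⟨i, Finset.mem_univ _, ?_⟩
        simpa using (hM _).unique (hg _ i) hb.symm
  have hall := Finset.card_filter_add_card_filter_not (s := ({h | φ h = v} : Finset (E × Bool)))
    (fun h => h.1 ∈ F)
  rw [Finset.filter_filter, Finset.filter_filter, hout, hdeg] at hall
  have : (2 * p + 1) * μ v = p * μ v + (p + 1) * μ v := by ring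
  omega

end Gadget

/-! ### Translation between `Graph` and half-edges -/

lemma Set.ncard_eq_card_filter_coe {β : Type*} {s t : Set β} [Fintype s] (hts : t ⊆ s)
    (q : s → Prop) [DecidablePred q] (hq : ∀ e : s, q e ↔ e.1 ∈ t) :
    t.ncard = Finset.card {e : s | q e} := by
  rw [← Set.ncard_coe_finset, ← Set.ncard_image_of_injective _ Subtype.val_injective]
  congr 1
  ext e
  simp only [Set.mem_image, Finset.mem_coe, Finset.mem_filter, Finset.mem_univ, true_and, hq]
  exact ⟨fun h => ⟨⟨e, hts h⟩, h, rfl⟩, fun ⟨e', h, he⟩ => he ▸ h⟩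

namespace Graph

variable {α β : Type*}

lemma vertexDegree_restrict_eq_card (G : Graph α β) [Fintype G.edgeSet] [DecidableEq G.edgeSet]
    [DecidableEq G.vertexSet] (φ : G.edgeSet × Bool → G.vertexSet)
    (hφ : ∀ e : G.edgeSet, G.IsLink e (φ (e, false)) (φ (e, true)))
    (S : Set β) (T : Finset G.edgeSet) (hST : ∀ e, e ∈ T ↔ e.1 ∈ S) (v : G.vertexSet) :
    (G.restrict S).vertexDegree v = Finset.card {h : G.edgeSet × Bool | φ h = v ∧ h.1 ∈ T} := by
  classical
  have hnon (e : G.edgeSet) : (G.restrict S).IsNonloopAt e v ↔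
      ¬(φ (e, false) = v ↔ φ (e, true) = v) ∧ e ∈ T := by
    simp only [Graph.IsNonloopAt, Graph.restrict_isLink, hST, (hφ e).isLink_iff]
    constructor
    · rintro ⟨y, hy, hS, ⟨h1, h2⟩ | ⟨h1, h2⟩⟩ <;>
        simp [Subtype.ext_iff, h1, h2, hy, hS]
    · rintro ⟨h, hS⟩
      by_cases h1 : φ (e, false) = v
      · have h2 : φ (e, true) ≠ v := fun h2 => h (by simp [h1, h2])
        exact ⟨φ (e, true), fun h3 => h2 (Subtype.ext h3), by simp [h1, hS]⟩
      · have h2 : φ (e, true) = v := by tauto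
        exact ⟨φ (e, false), fun h3 => h1 (Subtype.ext h3), by simp [h2, hS]⟩
  have hloop (e : G.edgeSet) : (G.restrict S).IsLoopAt e v ↔
      (φ (e, false) = v ∧ φ (e, true) = v) ∧ e ∈ T := by
    simp only [Graph.IsLoopAt, Graph.restrict_isLink, hST, (hφ e).isLink_iff, Subtype.ext_iff]
    tauto
  rw [vertexDegree,
    Set.ncard_eq_card_filter_coe (s := G.edgeSet) (fun e he => ?_) _ fun e => (hnon e).symm,
    Set.ncard_eq_card_filter_coe (s := G.edgeSet) (fun e he => ?_) _ fun e => (hloop e).symm]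
  · simp only [Finset.card_filter, Fintype.sum_prod_type, Fintype.sum_bool]
    rw [Finset.mul_sum, ← Finset.sum_add_distrib]
    refine Finset.sum_congr rfl fun e _ => ?_
    by_cases h1 : φ (e, false) = v <;> by_cases h2 : φ (e, true) = v <;>
      by_cases h3 : e ∈ T <;> simp [h1, h2, h3]
  · exact he.2.edge_mem
  · obtain ⟨_, _, h⟩ := he
    exact h.2.edge_mem

lemma ncard_edgeCut_eq_card (G : Graph α β) [Fintype G.edgeSet] [DecidableEq G.vertexSet]
    (φ : G.edgeSet × Bool → G.vertexSet)
    (hφ : ∀ e : G.edgeSet, G.IsLink e (φ (e, false)) (φ (e, true))) (X : Finset G.vertexSet) :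
    (G.edgeCut (Subtype.val '' (X : Set G.vertexSet))).ncard =
      Finset.card {e | ¬(φ (e, false) ∈ X ↔ φ (e, true) ∈ X)} := by
  refine Set.ncard_eq_card_filter_coe ?_ _ fun e => ?_
  · rintro e ⟨x, -, y, -, h⟩
    exact h.edge_mem
  · have hmem (v : G.vertexSet) : v ∈ X ↔ v.1 ∈ Subtype.val '' (X : Set G.vertexSet) := by simp
    rw [hmem, hmem]
    constructor
    · intro h
      by_cases h1 : (φ (e, false)).1 ∈ Subtype.val '' (X : Set G.vertexSet)
      · exact ⟨_, h1, _, fun h2 => h (iff_of_true h1 h2), hφ e⟩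
      · exact ⟨_, by tauto, _, h1, (hφ e).symm⟩
    · rintro ⟨x, hx, y, hy, h⟩
      obtain ⟨h1, h2⟩ | ⟨h1, h2⟩ := (hφ e).isLink_iff.1 h <;> rw [h1, h2] <;> tauto

end Graph

theorem mainTheorem5 {α β : Type*} (G : Graph α β)
    (hV : G.vertexSet.Finite) (hE : G.edgeSet.Finite) (p : ℕ)
    (hG : ((2 * p + 1 : ℕ) : ℕ∞) ≤ G.oddEdgeConnectivity)
    (μ : α → ℕ) (hμ : ∀ v ∈ G.vertexSet, 0 < μ v)
    (hdeg : ∀ v ∈ G.vertexSet, G.vertexDegree v = (2 * p + 1) * μ v) :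
    ∃ F : Graph α β, F.IsSpanningSubgraph G ∧
      ∀ v ∈ G.vertexSet, F.vertexDegree v = p * μ v := by
  classical
  have := hV.fintype
  have := hE.fintype
  have hspan (S : Set β) : (G.restrict S).IsSpanningSubgraph G := ⟨Graph.restrict_le, rfl⟩
  choose x y hxy using fun e : G.edgeSet => Graph.exists_isLink_of_mem_edgeSet e.2
  let φ : G.edgeSet × Bool → G.vertexSet := fun h =>
    if h.2 then ⟨y h.1, (hxy h.1).right_mem⟩ else ⟨x h.1, (hxy h.1).left_mem⟩
  have hφ (e : G.edgeSet) : G.IsLink e (φ (e, false)) (φ (e, true)) := by simpa [φ] using hxy e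
  have hrestrict := G.vertexDegree_restrict_eq_card φ hφ
  rcases Nat.eq_zero_or_pos p with rfl | hp
  -- For `p = 0` crossing edges may cost nothing, so the gadget bound is unavailable; the edgeless
  -- subgraph works.
  · refine ⟨G.restrict ∅, hspan ∅, fun v hv => ?_⟩
    simpa using hrestrict ∅ ∅ (by simp) ⟨v, hv⟩
  obtain ⟨F, hF⟩ := exists_factor_of_halfEdges φ p hp (fun v => μ v) (fun v => hμ v v.2)
    (fun v => by
      -- Restricting to all edges turns the formula for subgraph degrees into one for `G` itself.
      have h := hrestrict G.edgeSet Finset.univ (by simp) v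
      rw [G.restrict_self, hdeg v v.2] at h
      simpa using h.symm)
    (fun X hX => by
      rw [← G.ncard_edgeCut_eq_card φ hφ] at hX ⊢
      have hfin : (G.edgeCut (Subtype.val '' (X : Set G.vertexSet))).Finite :=
        hE.subset fun e ⟨_, _, _, _, h⟩ => h.edge_mem
      have hle := hG.trans (iInf₂_le _ ⟨hfin, hX⟩)
      rw [← hfin.cast_ncard_eq] at hle
      exact_mod_cast hle)
  refine ⟨G.restrict (Subtype.val '' (F : Set G.edgeSet)), hspan _, fun v hv => ?_⟩
  rw [← hF ⟨v, hv⟩]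
  exact hrestrict (Subtype.val '' (F : Set G.edgeSet)) F (by simp) ⟨v, hv⟩
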